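/- A \emph{path} is (the graph of) a continuous function $f:[0,1]\to\mathbb{R}$. A \emph{system of paths} is a finite set $S$ of at least three paths such that any two distinct paths of $S$ differ at $0$ and differ at $1$, meet in only finitely many points, and cross (i.e. exchange their vertical order) at every point where they meet, and no three distinct paths of $S$ have a common point. Its size is the number $|S|$ of its paths. The system $S$ is \emph{$k$-crossing} if any two distinct paths of $S$ cross at least once and at most $k$ times. A subsystem is a subset of at least three paths. A system is \emph{upper convex} (\emph{lower convex}) if for each of its paths $f$ there is a $t\in[0,1]$ at which $f$ lies strictly above (strictly below) all the other paths of the system. The \emph{signature} of a system of three paths, labelled $1,2,3$ from bottom to top in the order of their values at $0$, is the word in the letters $x,y,z$ obtained by listing all crossings from left to right and writing $x$, $y$, $z$ for a crossing of the paths $\{1,2\}$, $\{1,3\}$, $\{2,3\}$, respectively. Let $M_k$ be the number of distinct signatures of $k$-crossing systems of size $3$. Let $R_3(n;M)$ be the least integer $R\ge 0$ such that for every $N\geq R$ and every partition of the $3$-element subsets of $\{1,\dots,N\}$ into at most $M$ classes there is a set $A\subseteq\{1,\dots,N\}$ with $|A|\geq n$ all of whose $3$-element subsets lie in the same class. \textbf{Theorem.}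 Let $k\geq 1$ and $n\geq 3$ be integers. Then $M_k$ is finite, the Ramsey number $R_3(n;M_k)$ exists, and there exists a least positive integer $C_k(n)$ with the property that every $k$-crossing system of size at least $C_k(n)$ contains a subsystem of size $n$ that is upper convex or lower convex. Moreover, $C_k(n)\leq R_3(n;M_k)$. -/

import Mathlib

open scoped unitInterval
open Filter Topology

namespace PathSystem

/-- A path: (the graph of) a continuous function `[0,1] → ℝ`. -/
abbrev Path : Type := C(I, ℝ)

/-- The paths `f` and `g` cross at `t`: they meet there and exchange their vertical order. -/
def CrossAt (f g : Path) (t : I) : Prop :=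
  f t = g t ∧
    (((∀ᶠ s in 𝓝[<] t, f s < g s) ∧ (∀ᶠ s in 𝓝[>] t, g s < f s)) ∨
     ((∀ᶠ s in 𝓝[<] t, g s < f s) ∧ (∀ᶠ s in 𝓝[>] t, f s < g s)))

/-- A system of paths: a finite collection of at least three paths with distinct endpoints, such
that any two paths meet finitely often, cross wherever they meet, and no three paths meet in
a point. -/
structure IsSystem (S : Finset Path) : Prop where
  three_le_card : 3 ≤ S.card
  left_ne : ∀ f ∈ S, ∀ g ∈ S, f ≠ g → f 0 ≠ g 0
  right_ne : ∀ f ∈ S, ∀ g ∈ S, f ≠ g → f 1 ≠ g 1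
  finite_inter : ∀ f ∈ S, ∀ g ∈ S, f ≠ g → {t : I | f t = g t}.Finite
  cross : ∀ f ∈ S, ∀ g ∈ S, f ≠ g → ∀ t : I, f t = g t → CrossAt f g t
  no_triple : ∀ f ∈ S, ∀ g ∈ S, ∀ h ∈ S, f ≠ g → f ≠ h → g ≠ h →
    ∀ t : I, ¬ (f t = g t ∧ g t = h t)

/-- A system is `k`-crossing if any two of its paths cross at least once and at most `k` times. -/
def IsCrossingSystem (k : ℕ) (S : Finset Path) : Prop :=
  IsSystem S ∧ ∀ f ∈ S, ∀ g ∈ S, f ≠ g →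
    1 ≤ {t : I | f t = g t}.ncard ∧ {t : I | f t = g t}.ncard ≤ k

/-- `f` appears on the upper envelope of `S`. -/
def OnUpperEnvelope (S : Finset Path) (f : Path) : Prop :=
  ∃ t : I, ∀ g ∈ S, g ≠ f → g t < f t

/-- `f` appears on the lower envelope of `S`. -/
def OnLowerEnvelope (S : Finset Path) (f : Path) : Prop :=
  ∃ t : I, ∀ g ∈ S, g ≠ f → f t < g t

/-- All paths of `S` appear on its upper envelope. -/
def UpperConvex (S : Finset Path) : Prop := ∀ f ∈ S, OnUpperEnvelope S f

/-- All paths of `S` appear on its lower envelope. -/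
def LowerConvex (S : Finset Path) : Prop := ∀ f ∈ S, OnLowerEnvelope S f

/-- `C` is a positive integer such that every `k`-crossing system of size at least `C` contains
a subsystem of size `n` that is upper convex or lower convex. -/
def CupsCapsBound (k n C : ℕ) : Prop :=
  0 < C ∧ ∀ S : Finset Path, IsCrossingSystem k S → C ≤ S.card →
    ∃ T ⊆ S, T.card = n ∧ (UpperConvex T ∨ LowerConvex T)

/-- The letters used in signatures. -/
inductive Letter : Type
  | x
  | y
  | z

/-- The letter `x`, `y`, `z` marks the meetings of the paths 1 and 2, 1 and 3, 2 and 3. -/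
def MarkedBy (f₁ f₂ f₃ : Path) (t : I) : Letter → Prop
  | Letter.x => f₁ t = f₂ t
  | Letter.y => f₁ t = f₃ t
  | Letter.z => f₂ t = f₃ t

/-- `w` is the signature of the system `S` of size 3: the paths are labelled 1, 2, 3 from bottom
to top according to their left endpoints, `ts` lists all the crossings from left to right, and `w`
records, letter by letter, which two paths cross there. -/
def HasSignature (S : Finset Path) (w : List Letter) : Prop :=
  ∃ f₁ f₂ f₃ : Path, (S : Set Path) = {f₁, f₂, f₃} ∧ f₁ 0 < f₂ 0 ∧ f₂ 0 < f₃ 0 ∧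
    ∃ ts : List I, ts.Pairwise (· < ·) ∧
      (∀ t : I, t ∈ ts ↔ f₁ t = f₂ t ∨ f₁ t = f₃ t ∨ f₂ t = f₃ t) ∧
      List.Forall₂ (MarkedBy f₁ f₂ f₃) ts w

/-- The set of all signatures of `k`-crossing systems of size 3. -/
def signatures (k : ℕ) : Set (List Letter) :=
  {w | ∃ S : Finset Path, IsCrossingSystem k S ∧ S.card = 3 ∧ HasSignature S w}

/-- For all `N ≥ R` and every partition of the triples of an `N`-element set into at most `M`
classes there is a set of at least `n` elements all of whose triples are in the same class. -/
def RamseyBound (n M R : ℕ) : Prop :=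
  ∀ N : ℕ, R ≤ N → ∀ c : {T : Finset (Fin N) // T.card = 3} → Fin M,
    ∃ A : Finset (Fin N), n ≤ A.card ∧
      ∀ T T' : {T : Finset (Fin N) // T.card = 3}, T.1 ⊆ A → T'.1 ⊆ A → c T = c T'

end PathSystem

/-!
The argument runs through the *profile* of three paths `f`, `g`, `h` (ordered by their left
endpoints): the set of triples `(N_fg(t), N_fh(t), N_gh(t))`, where `N_fg(t)`, called
`crossCount f g t`, is the number of crossings of `f` and `g` in `[0, t]`. Since paths cross wherever
they meet, the parity of `N_fg(t)` tells which of `f` and `g` is above the other at `t`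
(`IsPair.lt_iff_even`). The profile consists of the letter counts of the initial segments of the
signature (`HasSignature.profile_eq`), so Ramsey's theorem for triples, coloured by their
signatures, yields a subsystem in which all triples have the same profile `P`. It remains to see that
such a subsystem is upper or lower convex.

For three paths this holds without any further assumption: a path that is never on top and a path
that is never at the bottom could not cross each other
(`IsSystem.convex_of_card_eq_three`).

For at least four paths, suppose `(x, r, r)`, `(q, q, z)` and `(r, y, q)` lie in `P` for some
`x, y, z`. Then for every path `f` any two of the conditions "`f` has crossed `g` exactly `r` times"
(`g` starting below `f`) and "`f` has crossed `h` exactly `q` times" (`h` starting above `f`) hold at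
a common time. Each of them holds on an interval, so by the one-dimensional Helly theorem there is a
time at which all of them hold (`IsSystem.exists_common_time`). If `r` is even and `q` is odd, `f` is
then on top; if `r` is odd and `q` is even, `f` is then at the bottom.

To find such `r` and `q`, take four paths `1, 2, 3, 4` in this order. The first time at which two
paths have crossed `a` times looks the same in every triple (`eq_at_first`). Hence:

* At the first crossing of `1` and `4`, the path `2` has crossed `1` as often as `3` has, which gives
  some `(u, u, _)` in `P`, and it has crossed `4` as often as `3` has, which gives `(_, v, v)`
  in `P`. As `2` is not between `1` and `4` at this time, exactly one of `u` and `v` is odd.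
* If `(_, p, p)` is in `P`, then at the first time when `1` and `2` have crossed `p` times, the path
  `2` has crossed `3` and `4` equally often, say `s` times. So `(s, s, _)` and `(p, _, s)` are in `P`.
* Symmetrically, if `(q, q, _)` is in `P`, then the number `r` of crossings of `1` and `2` at the
  first time when `2` and `3` have crossed `q` times satisfies `(_, r, r)`, `(r, _, q)` in `P`.

If `s` is always odd for odd `p`, and `r` always odd for odd `q`, then for the least odd `p` and `q`
each of the two first times precedes the other, so they coincide and `1`, `2`, `3` have a common
point, which is excluded (`IsSystem.convex_of_hasProfile`).
-/

namespace PathSystem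

/-! ### Counting the crossings of two paths -/

/-- Two paths of a system, the first one starting below the second one. -/
structure IsPair (f g : Path) : Prop where
  left : f 0 < g 0
  right : f 1 ≠ g 1
  finite : {t : I | f t = g t}.Finite
  cross : ∀ t : I, f t = g t → CrossAt f g t

/-- The number of times in `[0, t]` at which `f` and `g` meet. -/
noncomputable def crossCount (f g : Path) (t : I) : ℕ := {s : I | s ≤ t ∧ f s = g s}.ncard

theorem crossCount_comm (f g : Path) : crossCount f g = crossCount g f := by
  funext t
  simp only [crossCount, eq_comm]

variable {f g : Path}

theorem IsPair.finite_le (H : IsPair f g) (t : I) : {s : I | s ≤ t ∧ f s = g s}.Finite :=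
  H.finite.subset fun _ hs => hs.2

theorem IsPair.monotone (H : IsPair f g) : Monotone (crossCount f g) := fun _ t hst =>
  Set.ncard_le_ncard (fun _ hu => ⟨hu.1.trans hst, hu.2⟩) (H.finite_le t)

theorem IsPair.crossCount_zero (H : IsPair f g) : crossCount f g 0 = 0 := by
  have : {s : I | s ≤ 0 ∧ f s = g s} = ∅ := by
    ext s
    simp only [Set.mem_ofPred_eq, Set.mem_empty_iff_false, iff_false, not_and]
    intro hs
    rw [le_antisymm hs (zero_le (a := s))]
    exact H.left.ne
  rw [crossCount, this, Set.ncard_empty]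

theorem IsPair.pos_of_meet (H : IsPair f g) {t : I} (ht : f t = g t) : 0 < t :=
  lt_of_le_of_ne (zero_le (a := t)) fun h0 => H.left.ne (by rw [h0, ht])

theorem IsPair.lt_one_of_meet (H : IsPair f g) {t : I} (ht : f t = g t) : t < 1 :=
  lt_of_le_of_ne le_top fun h0 => H.right (by rw [← h0, ht])

/-- If there is a meeting in `[0, t]`, there is a last one. -/
theorem IsPair.exists_last (H : IsPair f g) {t : I} (ht : 0 < crossCount f g t) :
    ∃ u ≤ t, f u = g u ∧ crossCount f g u = crossCount f g t ∧
      ∀ s, u < s → s ≤ t → f s ≠ g s := by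
  have hne := Set.nonempty_of_ncard_ne_zero ht.ne'
  obtain ⟨u, hu, hmax⟩ := Set.exists_max_image _ id (H.finite_le t) hne
  refine ⟨u, hu.1, hu.2, ?_, fun s hus hst hs => (hmax s ⟨hst, hs⟩).not_gt hus⟩
  unfold crossCount
  congr 1
  ext s
  exact ⟨fun hs => ⟨hs.1.trans hu.1, hs.2⟩, fun hs => ⟨hmax s hs, hs.2⟩⟩

/-- Just before a meeting, the count is smaller by one. -/
theorem IsPair.eventually_left (H : IsPair f g) {u : I} (hu : f u = g u) :
    ∀ᶠ s in 𝓝[<] u, f s ≠ g s ∧ crossCount f g s + 1 = crossCount f g u := by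
  have h1 : ∀ᶠ s in 𝓝[<] u, ∀ z ∈ {z : I | f z = g z}, z < u → z < s := by
    rw [eventually_all_finite H.finite]
    intro z _
    by_cases hz : z < u
    · filter_upwards [Ioo_mem_nhdsLT hz] with s hs _ using hs.1
    · exact Eventually.of_forall fun s h => absurd h hz
  filter_upwards [h1, self_mem_nhdsWithin] with s hs (hsu : s < u)
  refine ⟨fun e => lt_irrefl _ (hs s e hsu), ?_⟩
  have : {z : I | z ≤ u ∧ f z = g z} = insert u {z : I | z ≤ s ∧ f z = g z} := by
    ext z
    simp only [Set.mem_ofPred_eq, Set.mem_insert_iff]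
    constructor
    · rintro ⟨hz, e⟩
      rcases hz.eq_or_lt with rfl | hz
      · exact Or.inl rfl
      · exact Or.inr ⟨(hs z e hz).le, e⟩
    · rintro (rfl | ⟨hz, e⟩)
      · exact ⟨le_rfl, hu⟩
      · exact ⟨hz.trans hsu.le, e⟩
  rw [crossCount, crossCount, this,
    Set.ncard_insert_of_notMem (fun hz => hz.1.not_gt hsu) (H.finite_le s)]

/-- The count is right-continuous. -/
theorem IsPair.eventually_right (H : IsPair f g) (t : I) :
    ∀ᶠ s in 𝓝[>] t, f s ≠ g s ∧ crossCount f g s = crossCount f g t := by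
  have h1 : ∀ᶠ s in 𝓝[>] t, ∀ z ∈ {z : I | f z = g z}, t < z → s < z := by
    rw [eventually_all_finite H.finite]
    intro z _
    by_cases hz : t < z
    · filter_upwards [Ioo_mem_nhdsGT hz] with s hs _ using hs.2
    · exact Eventually.of_forall fun s h => absurd h hz
  filter_upwards [h1, self_mem_nhdsWithin] with s hs (hts : t < s)
  refine ⟨fun e => lt_irrefl _ (hs s e hts), ?_⟩
  unfold crossCount
  congr 1
  ext z
  constructor
  · rintro ⟨hz, e⟩
    exact ⟨not_lt.mp fun hlt => (hs z e hlt).not_ge hz, e⟩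
  · rintro ⟨hz, e⟩
    exact ⟨hz.trans hts.le, e⟩

theorem nhdsLT_neBot {u : I} (hu : 0 < u) : (𝓝[<] u).NeBot :=
  nhdsLT_neBot_of_exists_lt ⟨0, hu⟩

theorem nhdsGT_neBot {u : I} (hu : u < 1) : (𝓝[>] u).NeBot :=
  nhdsGT_neBot_of_exists_gt ⟨1, hu⟩

/-- The first time at which `a` meetings have taken place. -/
theorem IsPair.exists_first (H : IsPair f g) {a : ℕ} {t₀ : I} (ha : a ≤ crossCount f g t₀) :
    ∃ t, crossCount f g t = a ∧ (∀ s, a ≤ crossCount f g s → t ≤ s) ∧ (0 < a → f t = g t) := by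
  rcases Nat.eq_zero_or_pos a with rfl | hpos
  · exact ⟨0, H.crossCount_zero, fun s _ => zero_le (a := s), fun h => absurd h (lt_irrefl _)⟩
  obtain ⟨u₀, -, hu₀, hc₀, -⟩ := H.exists_last (hpos.trans_le ha)
  obtain ⟨t, ht, hmin⟩ := Set.exists_min_image {s : I | f s = g s ∧ a ≤ crossCount f g s} id
    (H.finite.subset fun _ hs => hs.1) ⟨u₀, hu₀, hc₀ ▸ ha⟩
  have hleast : ∀ s, a ≤ crossCount f g s → t ≤ s := fun s hs => by
    obtain ⟨u, hus, hu, hc, -⟩ := H.exists_last (hpos.trans_le hs)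
    exact (hmin u ⟨hu, hc ▸ hs⟩).trans hus
  refine ⟨t, le_antisymm (not_lt.mp fun hlt => ?_) ht.2, hleast, fun _ => ht.1⟩
  have := nhdsLT_neBot (H.pos_of_meet ht.1)
  obtain ⟨s, ⟨-, hs⟩, hst⟩ := ((H.eventually_left ht.1).and self_mem_nhdsWithin).exists
  exact (hleast s (by omega)).not_gt hst

/-- Two paths keep their order on an interval where they do not meet. -/
theorem lt_iff_lt_of_no_meet {s t : I} (hst : s ≤ t) (hne : ∀ u, s ≤ u → u ≤ t → f u ≠ g u) :
    f s < g s ↔ f t < g t := by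
  have hpre : IsPreconnected (Set.Icc s t) := isPreconnected_Icc
  have hs : s ∈ Set.Icc s t := ⟨le_rfl, hst⟩
  have ht : t ∈ Set.Icc s t := ⟨hst, le_rfl⟩
  constructor
  · intro h1
    by_contra h2
    obtain ⟨u, hu, e⟩ := hpre.intermediate_value₂ hs ht f.continuous.continuousOn
      g.continuous.continuousOn h1.le (not_lt.mp h2)
    exact hne u hu.1 hu.2 e
  · intro h1
    by_contra h2
    obtain ⟨u, hu, e⟩ := hpre.intermediate_value₂ ht hs f.continuous.continuousOn
      g.continuous.continuousOn h1.le (not_lt.mp h2)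
    exact hne u hu.1 hu.2 e

/-- The parity of the number of crossings determines the vertical order. -/
theorem IsPair.lt_iff_even (H : IsPair f g) {t : I} (ht : f t ≠ g t) :
    f t < g t ↔ Even (crossCount f g t) := by
  induction hn : crossCount f g t generalizing t with
  | zero =>
    have hno : ∀ u, 0 ≤ u → u ≤ t → f u ≠ g u := fun u _ hut e => by
      rw [crossCount, Set.ncard_eq_zero (H.finite_le t)] at hn
      exact (hn ▸ (show u ∈ {s : I | s ≤ t ∧ f s = g s} from ⟨hut, e⟩) : u ∈ (∅ : Set I))
    simpa using (lt_iff_lt_of_no_meet (zero_le (a := t)) hno).mp H.left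
  | succ n ih =>
    obtain ⟨u, hut, hu, hc, hno⟩ := H.exists_last (t := t) (by omega)
    have hut' : u < t := lt_of_le_of_ne hut fun e => ht (e ▸ hu)
    have := nhdsLT_neBot (H.pos_of_meet hu)
    have := nhdsGT_neBot (H.lt_one_of_meet hu)
    have hL := H.eventually_left hu
    have hR : ∀ᶠ s in 𝓝[>] u, f s < g s ↔ f t < g t := by
      filter_upwards [Ioo_mem_nhdsGT hut'] with s hs
      exact lt_iff_lt_of_no_meet hs.2.le fun v hv hvt => hno v (hs.1.trans_le hv) hvt
    rw [Nat.even_add_one]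
    rcases (H.cross u hu).2 with ⟨h1, h2⟩ | ⟨h1, h2⟩
    · obtain ⟨s, ⟨hs, hsc⟩, hlt⟩ := (hL.and h1).exists
      obtain ⟨s', hs', hgt⟩ := (hR.and h2).exists
      have := ih hs (by omega)
      rw [← hs', ← this]
      exact ⟨fun h => absurd h hgt.not_gt, fun h => absurd hlt h⟩
    · obtain ⟨s, ⟨hs, hsc⟩, hgt⟩ := (hL.and h1).exists
      obtain ⟨s', hs', hlt⟩ := (hR.and h2).exists
      have := ih hs (by omega)
      rw [← hs', ← this]
      exact ⟨fun _ => hgt.not_gt, fun _ => hlt⟩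

theorem IsSystem.isPair {S : Finset Path} (hS : IsSystem S) (hf : f ∈ S) (hg : g ∈ S)
    (h0 : f 0 < g 0) : IsPair f g :=
  have hne : f ≠ g := fun e => h0.ne (by rw [e])
  ⟨h0, hS.right_ne f hf g hg hne, hS.finite_inter f hf g hg hne, hS.cross f hf g hg hne⟩

/-- For every time there is a time with the same counts at which a given path of the system meets
no other path. -/
theorem IsSystem.exists_generic_time {S : Finset Path} (hS : IsSystem S) (hf : f ∈ S) (t : I) :
    ∃ s, ∀ g ∈ S, g ≠ f → f s ≠ g s ∧ crossCount f g s = crossCount f g t := by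
  rcases eq_or_lt_of_le (show t ≤ 1 from le_top) with rfl | ht
  · exact ⟨1, fun g hg hne => ⟨hS.right_ne f hf g hg hne.symm, rfl⟩⟩
  have := nhdsGT_neBot ht
  have : ∀ᶠ s in 𝓝[>] t, ∀ g ∈ S, g ≠ f → f s ≠ g s ∧ crossCount f g s = crossCount f g t := by
    rw [S.eventually_all]
    intro g hg
    by_cases hne : g = f
    · exact Eventually.of_forall fun s h => absurd hne h
    rcases lt_or_gt_of_ne (hS.left_ne f hf g hg (Ne.symm hne)) with h | h
    · filter_upwards [(hS.isPair hf hg h).eventually_right t] with s hs _ using hs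
    · filter_upwards [(hS.isPair hg hf h).eventually_right t] with s hs _
      rw [crossCount_comm f g]
      exact ⟨hs.1.symm, hs.2⟩
  exact this.exists

/-! ### Systems in which all triples have the same profile -/

/-- The profile of three paths: all triples of crossing counts (of the pairs `{f, g}`, `{f, h}` and
`{g, h}`) that occur as the time runs through `[0, 1]`. -/
def profile (f g h : Path) : Set (ℕ × ℕ × ℕ) :=
  Set.range fun t => (crossCount f g t, crossCount f h t, crossCount g h t)

/-- All triples of paths of `S`, ordered by their left endpoints, have the profile `P`. -/
def HasProfile (S : Finset Path) (P : Set (ℕ × ℕ × ℕ)) : Prop :=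
  ∀ f ∈ S, ∀ g ∈ S, ∀ h ∈ S, f 0 < g 0 → g 0 < h 0 → profile f g h = P

theorem mem_profile {f g h : Path} {a b c : ℕ} : (a, b, c) ∈ profile f g h ↔
    ∃ t, crossCount f g t = a ∧ crossCount f h t = b ∧ crossCount g h t = c := by
  simp [profile]

theorem mem_profile_self (f g h : Path) (t : I) :
    (crossCount f g t, crossCount f h t, crossCount g h t) ∈ profile f g h := ⟨t, rfl⟩

/-- If two pairs of monotone functions take the same pairs of values, then the values
of the second functions agree at the first times at which the first functions reach `a`. -/
theorem eq_at_first {α β α' β' : I → ℕ} {a : ℕ} {t t' : I}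
    (h : ∀ s, ∃ s', α' s' = α s ∧ β' s' = β s) (h' : ∀ s', ∃ s, α s = α' s' ∧ β s = β' s')
    (hβ : Monotone β) (hβ' : Monotone β') (ha : α t = a) (ha' : α' t' = a)
    (ht : ∀ s, a ≤ α s → t ≤ s) (ht' : ∀ s, a ≤ α' s → t' ≤ s) : β t = β' t' := by
  obtain ⟨s', h1, h2⟩ := h t
  obtain ⟨s, h3, h4⟩ := h' t'
  have h5 := hβ' (ht' s' (by omega))
  have h6 := hβ (ht s (by omega))
  omega

/-- One-dimensional Helly argument: if, for any two paths of `S` other than `f`, the prescribed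
numbers `a` of crossings with `f` are attained simultaneously, then all of them are. -/
theorem IsSystem.exists_common_time {S : Finset Path} (hS : IsSystem S) (hf : f ∈ S)
    (a : Path → ℕ)
    (hpair : ∀ g ∈ S, ∀ h ∈ S, g ≠ f → h ≠ f → g 0 < h 0 →
      ∃ t, crossCount f g t = a g ∧ crossCount f h t = a h) :
    ∃ t, ∀ g ∈ S, g ≠ f → crossCount f g t = a g := by
  classical
  have hpair' : ∀ g ∈ S, ∀ h ∈ S, g ≠ f → h ≠ f → g ≠ h →
      ∃ t, crossCount f g t = a g ∧ crossCount f h t = a h := by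
    intro g hg h hh hgf hhf hgh
    rcases lt_or_gt_of_ne (hS.left_ne g hg h hh hgh) with h0 | h0
    · exact hpair g hg h hh hgf hhf h0
    · obtain ⟨t, h1, h2⟩ := hpair h hh g hg hhf hgf h0
      exact ⟨t, h2, h1⟩
  have hmono : ∀ g ∈ S, g ≠ f → Monotone (crossCount f g) := by
    intro g hg hgf
    rcases lt_or_gt_of_ne (hS.left_ne f hf g hg hgf.symm) with h0 | h0
    · exact (hS.isPair hf hg h0).monotone
    · rw [crossCount_comm]
      exact (hS.isPair hg hf h0).monotone
  have hfirst : ∀ g, ∃ t, g ∈ S → g ≠ f →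
      crossCount f g t = a g ∧ ∀ s, a g ≤ crossCount f g s → t ≤ s := by
    intro g
    by_cases hg : g ∈ S ∧ g ≠ f
    · obtain ⟨hg, hgf⟩ := hg
      -- A third path guarantees that the count `a g` is attained at all.
      obtain ⟨h, hh, hhg⟩ := Finset.exists_mem_ne (s := S.erase f)
        (by rw [Finset.card_erase_of_mem hf]; have := hS.three_le_card; omega) g
      obtain ⟨t₀, ht₀, -⟩ := hpair' g hg h (Finset.mem_of_mem_erase hh) hgf
        (Finset.ne_of_mem_erase hh) hhg.symm
      rcases lt_or_gt_of_ne (hS.left_ne f hf g hg hgf.symm) with h0 | h0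
      · obtain ⟨t, h1, h2, -⟩ := (hS.isPair hf hg h0).exists_first ht₀.ge
        exact ⟨t, fun _ _ => ⟨h1, h2⟩⟩
      · rw [crossCount_comm] at ht₀ ⊢
        obtain ⟨t, h1, h2, -⟩ := (hS.isPair hg hf h0).exists_first ht₀.ge
        exact ⟨t, fun _ _ => ⟨h1, h2⟩⟩
    · exact ⟨0, fun h1 h2 => absurd ⟨h1, h2⟩ hg⟩
  choose T hT using hfirst
  -- The latest of the first times works.
  obtain ⟨m, hm, hmax⟩ := Finset.exists_max_image (S.erase f) T
    (Finset.card_pos.mp (by rw [Finset.card_erase_of_mem hf]; have := hS.three_le_card; omega))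
  have hmS := Finset.mem_of_mem_erase hm
  have hmf := Finset.ne_of_mem_erase hm
  refine ⟨T m, fun g hg hgf => ?_⟩
  by_cases hgm : g = m
  · rw [hgm]
    exact (hT m hmS hmf).1
  obtain ⟨t, h1, h2⟩ := hpair' g hg m hmS hgf hmf hgm
  have h3 := hmono g hg hgf ((hT m hmS hmf).2 t h2.ge)
  have h4 := hmono g hg hgf (hmax g (Finset.mem_erase.mpr ⟨hgf, hg⟩))
  have h5 := (hT g hg hgf).1
  omega

/-- At some time, `f` has crossed all paths starting below it `r` times and all paths starting above
it `q` times, so that the parities of `r` and `q` determine the position of `f` among them. -/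
theorem IsSystem.exists_counts {S : Finset Path} (hS : IsSystem S) {P : Set (ℕ × ℕ × ℕ)}
    (hP : HasProfile S P) {r q x y z : ℕ} (hr : (x, r, r) ∈ P) (hq : (q, q, z) ∈ P)
    (hrq : (r, y, q) ∈ P) (hf : f ∈ S) :
    ∃ t, ∀ g ∈ S, g ≠ f → (g 0 < f 0 → (g t < f t ↔ Even r) ∧ (f t < g t ↔ ¬ Even r)) ∧
      (f 0 < g 0 → (f t < g t ↔ Even q) ∧ (g t < f t ↔ ¬ Even q)) := by
  classical
  obtain ⟨t, ht⟩ := hS.exists_common_time hf (fun g => if g 0 < f 0 then r else q) (by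
    intro g hg h hh hgf hhf h0
    rcases lt_or_gt_of_ne (hS.left_ne f hf g hg hgf.symm) with hfg | hfg
    · obtain ⟨t, h1, h2, -⟩ := mem_profile.mp (hP f hf g hg h hh hfg h0 ▸ hq)
      exact ⟨t, by simp [hfg.not_gt, h1], by simp [(hfg.trans h0).not_gt, h2]⟩
    · rcases lt_or_gt_of_ne (hS.left_ne f hf h hh hhf.symm) with hfh | hfh
      · obtain ⟨t, h1, -, h2⟩ := mem_profile.mp (hP g hg f hf h hh hfg hfh ▸ hrq)
        exact ⟨t, by simp [hfg, h1, crossCount_comm f g], by simp [hfh.not_gt, h2]⟩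
      · obtain ⟨t, -, h1, h2⟩ := mem_profile.mp (hP g hg h hh f hf h0 hfh ▸ hr)
        exact ⟨t, by simp [hfg, h1, crossCount_comm f g],
          by simp [hfh, h2, crossCount_comm f h]⟩)
  obtain ⟨s, hs⟩ := hS.exists_generic_time hf t
  refine ⟨s, fun g hg hgf => ?_⟩
  obtain ⟨hne, hc⟩ := hs g hg hgf
  rw [ht g hg hgf] at hc
  constructor
  · intro h0
    have := (hS.isPair hg hf h0).lt_iff_even hne.symm
    rw [crossCount_comm, hc, if_pos h0] at this
    exact ⟨this, by rw [← this, not_lt]; exact ⟨le_of_lt, fun h => lt_of_le_of_ne h hne⟩⟩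
  · intro h0
    have := (hS.isPair hf hg h0).lt_iff_even hne
    rw [hc, if_neg h0.not_gt] at this
    exact ⟨this, by rw [← this, not_lt]; exact ⟨le_of_lt, fun h => lt_of_le_of_ne h hne.symm⟩⟩

theorem IsSystem.upperConvex_of_profile {S : Finset Path} (hS : IsSystem S)
    {P : Set (ℕ × ℕ × ℕ)} (hP : HasProfile S P) {r q x y z : ℕ} (hr : (x, r, r) ∈ P)
    (hq : (q, q, z) ∈ P) (hrq : (r, y, q) ∈ P) (her : Even r) (hoq : ¬ Even q) :
    UpperConvex S := by
  intro f hf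
  obtain ⟨t, ht⟩ := hS.exists_counts hP hr hq hrq hf
  refine ⟨t, fun g hg hgf => ?_⟩
  rcases lt_or_gt_of_ne (hS.left_ne g hg f hf hgf) with h0 | h0
  · exact (((ht g hg hgf).1 h0).1).mpr her
  · exact (((ht g hg hgf).2 h0).2).mpr hoq

theorem IsSystem.lowerConvex_of_profile {S : Finset Path} (hS : IsSystem S)
    {P : Set (ℕ × ℕ × ℕ)} (hP : HasProfile S P) {r q x y z : ℕ} (hr : (x, r, r) ∈ P)
    (hq : (q, q, z) ∈ P) (hrq : (r, y, q) ∈ P) (hor : ¬ Even r) (heq : Even q) :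
    LowerConvex S := by
  intro f hf
  obtain ⟨t, ht⟩ := hS.exists_counts hP hr hq hrq hf
  refine ⟨t, fun g hg hgf => ?_⟩
  rcases lt_or_gt_of_ne (hS.left_ne g hg f hf hgf) with h0 | h0
  · exact (((ht g hg hgf).1 h0).2).mpr hor
  · exact (((ht g hg hgf).2 h0).1).mpr heq

/-- The paths of a system, listed by their left endpoints. -/
theorem IsSystem.exists_sorted {S : Finset Path} (hS : IsSystem S) {n : ℕ} (hn : S.card = n) :
    ∃ e : Fin n → Path, (∀ i, e i ∈ S) ∧ StrictMono (fun i => e i 0) ∧ ∀ f ∈ S, ∃ i, e i = f := by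
  classical
  have hinj : Set.InjOn (fun f : Path => f 0) S := fun f hf g hg hfg => by
    by_contra hne
    exact hS.left_ne f hf g hg hne hfg
  have hc : (S.image fun f : Path => f 0).card = n := by
    rw [Finset.card_image_of_injOn hinj, hn]
  have hmem : ∀ i, ∃ f ∈ S, f 0 = (S.image fun f : Path => f 0).orderEmbOfFin hc i := fun i =>
    Finset.mem_image.mp (Finset.orderEmbOfFin_mem _ hc i)
  choose e he he' using hmem
  refine ⟨e, he, fun i j hij => ?_, fun f hf => ?_⟩
  · simp only [he']
    exact (OrderEmbedding.strictMono _) hij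
  · have hf' : f 0 ∈ Set.range ((S.image fun f : Path => f 0).orderEmbOfFin hc) := by
      rw [Finset.range_orderEmbOfFin]
      exact Finset.mem_coe.mpr (Finset.mem_image_of_mem _ hf)
    obtain ⟨i, hi⟩ := hf'
    exact ⟨i, hinj (he i) hf ((he' i).trans hi)⟩

/-- The core of the argument: a system of at least four paths all of whose triples have the same
profile is upper convex or lower convex. -/
theorem IsSystem.convex_of_hasProfile {S : Finset Path} (hS : IsSystem S) (h4 : 4 ≤ S.card)
    (hmeet : ∀ f ∈ S, ∀ g ∈ S, f ≠ g → ∃ t, f t = g t) {P : Set (ℕ × ℕ × ℕ)}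
    (hP : HasProfile S P) : UpperConvex S ∨ LowerConvex S := by
  classical
  obtain ⟨e, heS, hmono, -⟩ := hS.exists_sorted rfl
  obtain ⟨f₁, f₂, f₃, f₄, m₁, m₂, m₃, m₄, l₁₂, l₂₃, l₃₄⟩ : ∃ f₁ f₂ f₃ f₄ : Path,
      f₁ ∈ S ∧ f₂ ∈ S ∧ f₃ ∈ S ∧ f₄ ∈ S ∧ f₁ 0 < f₂ 0 ∧ f₂ 0 < f₃ 0 ∧ f₃ 0 < f₄ 0 :=
    ⟨e ⟨0, by omega⟩, e ⟨1, by omega⟩, e ⟨2, by omega⟩, e ⟨3, by omega⟩, heS _, heS _, heS _,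
      heS _, hmono (Fin.mk_lt_mk.mpr (by omega)), hmono (Fin.mk_lt_mk.mpr (by omega)),
      hmono (Fin.mk_lt_mk.mpr (by omega))⟩
  have l₁₃ := l₁₂.trans l₂₃
  have l₂₄ := l₂₃.trans l₃₄
  have l₁₄ := l₁₂.trans l₂₄
  have p₁₂ := hS.isPair m₁ m₂ l₁₂
  have p₁₃ := hS.isPair m₁ m₃ l₁₃
  have p₁₄ := hS.isPair m₁ m₄ l₁₄
  have p₂₃ := hS.isPair m₂ m₃ l₂₃
  have p₂₄ := hS.isPair m₂ m₄ l₂₄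
  have p₃₄ := hS.isPair m₃ m₄ l₃₄
  have P₁₂₃ := hP _ m₁ _ m₂ _ m₃ l₁₂ l₂₃
  have P₁₂₄ := hP _ m₁ _ m₂ _ m₄ l₁₂ l₂₄
  have P₁₃₄ := hP _ m₁ _ m₃ _ m₄ l₁₃ l₃₄
  have P₂₃₄ := hP _ m₂ _ m₃ _ m₄ l₂₃ l₃₄
  have transfer : ∀ {f g h f' g' h' : Path}, profile f g h = P → profile f' g' h' = P → ∀ s, ∃ s',
      crossCount f' g' s' = crossCount f g s ∧ crossCount f' h' s' = crossCount f h s ∧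
        crossCount g' h' s' = crossCount g h s := fun h h' s =>
    mem_profile.mp (h'.trans h.symm ▸ mem_profile_self _ _ _ s)
  -- The numbers `p`, `q` for which a path can have been crossed `p` times by all paths starting
  -- below it, respectively `q` times by all paths starting above it.
  set Below : ℕ → Prop := fun p => ∃ x, (x, p, p) ∈ P with hBelow
  set Above : ℕ → Prop := fun q => ∃ z, (q, q, z) ∈ P with hAbove
  have attain : ∀ t, ∃ s, crossCount f₁ f₂ s = crossCount f₂ f₃ t := fun t => by
    obtain ⟨s, hs, -⟩ := transfer P₂₃₄ P₁₂₃ t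
    exact ⟨s, hs⟩
  have attain' : ∀ t, ∃ s, crossCount f₂ f₃ s = crossCount f₁ f₂ t := fun t => by
    obtain ⟨s, hs, -⟩ := transfer P₁₂₃ P₂₃₄ t
    exact ⟨s, hs⟩
  -- At the first time at which `f₁`, `f₂` have crossed `p` times, `f₂` has crossed `f₃` and `f₄`
  -- equally often.
  have stepBelow : ∀ p, Below p → ∃ t, crossCount f₁ f₂ t = p ∧
      (∀ s, p ≤ crossCount f₁ f₂ s → t ≤ s) ∧ (0 < p → f₁ t = f₂ t) ∧
      Above (crossCount f₂ f₃ t) := by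
    rintro p ⟨x, hx⟩
    obtain ⟨t₀, -, -, h₀⟩ := mem_profile.mp (P₁₂₃ ▸ hx)
    obtain ⟨t₁, h₁⟩ := attain t₀
    obtain ⟨t, ht, hle, hcr⟩ := p₁₂.exists_first (a := p) (t₀ := t₁) (by omega)
    have h := eq_at_first (α := crossCount f₁ f₂) (β := crossCount f₂ f₃)
      (α' := crossCount f₁ f₂) (β' := crossCount f₂ f₄)
      (fun s => (transfer P₁₂₃ P₁₂₄ s).imp fun _ h => ⟨h.1, h.2.2⟩)
      (fun s => (transfer P₁₂₄ P₁₂₃ s).imp fun _ h => ⟨h.1, h.2.2⟩)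
      p₂₃.monotone p₂₄.monotone ht ht hle hle
    refine ⟨t, ht, hle, hcr, crossCount f₃ f₄ t, ?_⟩
    have := mem_profile_self f₂ f₃ f₄ t
    rwa [← h, P₂₃₄] at this
  -- The first time at which `f₂`, `f₃` have crossed `q` times looks like the first time at which
  -- `f₃`, `f₄` have done so; at the latter, `f₃` has crossed `f₁` and `f₂` equally often.
  have stepAbove : ∀ q, Above q → ∃ t, crossCount f₂ f₃ t = q ∧
      (∀ s, q ≤ crossCount f₂ f₃ s → t ≤ s) ∧ (0 < q → f₂ t = f₃ t) ∧
      Below (crossCount f₁ f₂ t) := by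
    rintro q ⟨z, hz⟩
    obtain ⟨t₀, h₀, -⟩ := mem_profile.mp (P₁₂₃ ▸ hz)
    obtain ⟨t₁, h₁⟩ := attain' t₀
    obtain ⟨t, ht, hle, hcr⟩ := p₂₃.exists_first (a := q) (t₀ := t₁) (by omega)
    obtain ⟨t₂, -, -, h₂⟩ := transfer P₁₂₃ P₁₃₄ t₁
    obtain ⟨t', ht', hle', -⟩ := p₃₄.exists_first (a := q) (t₀ := t₂) (by omega)
    have ha := eq_at_first (α := crossCount f₂ f₃) (β := crossCount f₁ f₂)
      (α' := crossCount f₃ f₄) (β' := crossCount f₁ f₃)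
      (fun s => (transfer P₁₂₃ P₁₃₄ s).imp fun _ h => ⟨h.2.2, h.1⟩)
      (fun s => (transfer P₁₃₄ P₁₂₃ s).imp fun _ h => ⟨h.2.2, h.1⟩)
      p₁₂.monotone p₁₃.monotone ht ht' hle hle'
    have hb := eq_at_first (α := crossCount f₂ f₃) (β := crossCount f₁ f₂)
      (α' := crossCount f₃ f₄) (β' := crossCount f₂ f₃)
      (fun s => (transfer P₁₂₃ P₂₃₄ s).imp fun _ h => ⟨h.2.2, h.1⟩)
      (fun s => (transfer P₂₃₄ P₁₂₃ s).imp fun _ h => ⟨h.2.2, h.1⟩)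
      p₁₂.monotone p₂₃.monotone ht ht' hle hle'
    refine ⟨t, ht, hle, hcr, crossCount f₁ f₂ t', ?_⟩
    have := mem_profile_self f₁ f₂ f₃ t'
    rwa [← ha, ← hb, P₁₂₃] at this
  -- At the first crossing of `f₁` and `f₄`, the paths `f₂` and `f₃` have crossed `f₁` equally often,
  -- as the triples `f₁, f₂, f₄` and `f₁, f₃, f₄` look alike, and likewise `f₄`. Since `f₂` is not
  -- between `f₁` and `f₄` at this time, one of the two numbers is odd.
  have hodd : (∃ p, Below p ∧ ¬ Even p) ∨ ∃ q, Above q ∧ ¬ Even q := by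
    have n₁₂ : f₁ ≠ f₂ := fun e => l₁₂.ne (by rw [e])
    have n₁₄ : f₁ ≠ f₄ := fun e => l₁₄.ne (by rw [e])
    have n₂₄ : f₂ ≠ f₄ := fun e => l₂₄.ne (by rw [e])
    obtain ⟨t₀, h₀⟩ := hmeet _ m₁ _ m₄ n₁₄
    have hpos : 1 ≤ crossCount f₁ f₄ t₀ :=
      (Set.ncard_pos (p₁₄.finite_le t₀)).mpr ⟨t₀, le_rfl, h₀⟩
    obtain ⟨t, ht, hle, hcr⟩ := p₁₄.exists_first hpos
    have hcr := hcr one_pos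
    have hx := eq_at_first (α := crossCount f₁ f₄) (β := crossCount f₁ f₂)
      (α' := crossCount f₁ f₄) (β' := crossCount f₁ f₃)
      (fun s => (transfer P₁₂₄ P₁₃₄ s).imp fun _ h => ⟨h.2.1, h.1⟩)
      (fun s => (transfer P₁₃₄ P₁₂₄ s).imp fun _ h => ⟨h.2.1, h.1⟩)
      p₁₂.monotone p₁₃.monotone ht ht hle hle
    have hz := eq_at_first (α := crossCount f₁ f₄) (β := crossCount f₂ f₄)
      (α' := crossCount f₁ f₄) (β' := crossCount f₃ f₄)
      (fun s => (transfer P₁₂₄ P₁₃₄ s).imp fun _ h => ⟨h.2.1, h.2.2⟩)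
      (fun s => (transfer P₁₃₄ P₁₂₄ s).imp fun _ h => ⟨h.2.1, h.2.2⟩)
      p₂₄.monotone p₃₄.monotone ht ht hle hle
    have hA : Above (crossCount f₁ f₂ t) := by
      refine ⟨crossCount f₂ f₃ t, ?_⟩
      have := mem_profile_self f₁ f₂ f₃ t
      rwa [← hx, P₁₂₃] at this
    have hB : Below (crossCount f₂ f₄ t) := by
      refine ⟨crossCount f₂ f₃ t, ?_⟩
      have := mem_profile_self f₂ f₃ f₄ t
      rwa [← hz, P₂₃₄] at this
    have t₁₂ : f₁ t ≠ f₂ t := fun h =>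
      hS.no_triple _ m₁ _ m₂ _ m₄ n₁₂ n₁₄ n₂₄ t ⟨h, h.symm.trans hcr⟩
    have t₂₄ : f₂ t ≠ f₄ t := fun h => t₁₂ (hcr.trans h.symm)
    by_cases he : Even (crossCount f₁ f₂ t)
    · refine Or.inl ⟨_, hB, fun he' => ?_⟩
      have h1 := (p₁₂.lt_iff_even t₁₂).mpr he
      have h2 := (p₂₄.lt_iff_even t₂₄).mpr he'
      exact (h1.trans h2).ne hcr
    · exact Or.inr ⟨_, hA, he⟩
  by_contra hno
  rw [not_or] at hno
  -- If `S` is not convex, every odd number of one kind leads to an odd number of the other kind.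
  have hBA : ∀ p, Below p → ¬ Even p → ∃ t, crossCount f₁ f₂ t = p ∧
      (∀ s, p ≤ crossCount f₁ f₂ s → t ≤ s) ∧ f₁ t = f₂ t ∧
      Above (crossCount f₂ f₃ t) ∧ ¬ Even (crossCount f₂ f₃ t) := by
    intro p hp hop
    obtain ⟨t, ht, hle, hcr, hA⟩ := stepBelow p hp
    refine ⟨t, ht, hle, hcr (Nat.pos_of_ne_zero fun h => hop (h ▸ Even.zero)), hA, fun he => ?_⟩
    obtain ⟨x, hx⟩ := hp
    obtain ⟨z, hz⟩ := hA
    have := mem_profile_self f₁ f₂ f₃ t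
    rw [ht, P₁₂₃] at this
    exact hno.2 (hS.lowerConvex_of_profile hP hx hz this hop he)
  have hAB : ∀ q, Above q → ¬ Even q → ∃ t, crossCount f₂ f₃ t = q ∧
      (∀ s, q ≤ crossCount f₂ f₃ s → t ≤ s) ∧ f₂ t = f₃ t ∧
      Below (crossCount f₁ f₂ t) ∧ ¬ Even (crossCount f₁ f₂ t) := by
    intro q hq hoq
    obtain ⟨t, ht, hle, hcr, hB⟩ := stepAbove q hq
    refine ⟨t, ht, hle, hcr (Nat.pos_of_ne_zero fun h => hoq (h ▸ Even.zero)), hB, fun he => ?_⟩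
    obtain ⟨z, hz⟩ := hq
    obtain ⟨x, hx⟩ := hB
    have := mem_profile_self f₁ f₂ f₃ t
    rw [ht, P₁₂₃] at this
    exact hno.1 (hS.upperConvex_of_profile hP hx hz this he hoq)
  have hexB : ∃ p, Below p ∧ ¬ Even p := by
    rcases hodd with h | ⟨q, hq, hoq⟩
    · exact h
    · obtain ⟨t, -, -, -, h⟩ := hAB q hq hoq
      exact ⟨_, h⟩
  have hexA : ∃ q, Above q ∧ ¬ Even q := by
    obtain ⟨p, hp, hop⟩ := hexB
    obtain ⟨t, -, -, -, h⟩ := hBA p hp hop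
    exact ⟨_, h⟩
  -- For the least odd numbers, the two first times coincide, so that three paths meet.
  obtain ⟨t, ht, hle, hcr, hA⟩ := hBA _ (Nat.find_spec hexB).1 (Nat.find_spec hexB).2
  obtain ⟨t', ht', hle', hcr', hB⟩ := hAB _ (Nat.find_spec hexA).1 (Nat.find_spec hexA).2
  have h1 := hle' t (Nat.find_min' hexA hA)
  have h2 := hle t' (Nat.find_min' hexB hB)
  obtain rfl := le_antisymm h1 h2
  exact hS.no_triple _ m₁ _ m₂ _ m₃ (fun e => l₁₂.ne (by rw [e])) (fun e => l₁₃.ne (by rw [e]))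
    (fun e => l₂₃.ne (by rw [e])) _ ⟨hcr, hcr'⟩

/-! ### Systems of three paths -/

/-- Near a crossing of `f` and `g`, either order of `f` and `g` is attained, with a third path `h`
on the same side of both. -/
theorem IsSystem.exists_lt_near {S : Finset Path} (hS : IsSystem S) {f g h : Path} (hf : f ∈ S)
    (hg : g ∈ S) (hh : h ∈ S) (hfg : f ≠ g) (hfh : f ≠ h) (hgh : g ≠ h)
    (hmeet : ∃ t, f t = g t) :
    ∃ s s', g s < f s ∧ f s' < g s' ∧
      ((f s < h s ∧ g s' < h s') ∨ (h s < g s ∧ h s' < f s')) := by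
  obtain ⟨t, ht⟩ := hmeet
  have h0 : 0 < t := lt_of_le_of_ne (zero_le (a := t)) fun e =>
    hS.left_ne f hf g hg hfg (by rw [e, ht])
  have h1 : t < 1 := lt_of_le_of_ne le_top fun e => hS.right_ne f hf g hg hfg (by rw [← e, ht])
  have := nhdsLT_neBot h0
  have := nhdsGT_neBot h1
  have hboth : ∀ {p : I → Prop}, (∀ᶠ s in 𝓝 t, p s) →
      ∃ s s', g s < f s ∧ f s' < g s' ∧ p s ∧ p s' := by
    intro p hp
    have hl := hp.filter_mono (nhdsWithin_le_nhds (s := Set.Iio t))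
    have hr := hp.filter_mono (nhdsWithin_le_nhds (s := Set.Ioi t))
    rcases (hS.cross f hf g hg hfg t ht).2 with ⟨h2, h3⟩ | ⟨h2, h3⟩
    · obtain ⟨s', h4, h5⟩ := (h2.and hl).exists
      obtain ⟨s, h6, h7⟩ := (h3.and hr).exists
      exact ⟨s, s', h6, h4, h7, h5⟩
    · obtain ⟨s, h4, h5⟩ := (h2.and hl).exists
      obtain ⟨s', h6, h7⟩ := (h3.and hr).exists
      exact ⟨s, s', h4, h6, h5, h7⟩
  have hne : f t ≠ h t := fun e =>
    hS.no_triple f hf g hg h hh hfg hfh hgh t ⟨ht, ht.symm.trans e⟩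
  rcases lt_or_gt_of_ne hne with hlt | hgt
  · obtain ⟨s, s', h2, h3, h4, h5⟩ := hboth
      ((f.continuous.continuousAt.eventually_lt h.continuous.continuousAt hlt).and
        (g.continuous.continuousAt.eventually_lt h.continuous.continuousAt (ht ▸ hlt)))
    exact ⟨s, s', h2, h3, Or.inl ⟨h4.1, h5.2⟩⟩
  · obtain ⟨s, s', h2, h3, h4, h5⟩ := hboth
      ((h.continuous.continuousAt.eventually_lt f.continuous.continuousAt hgt).and
        (h.continuous.continuousAt.eventually_lt g.continuous.continuousAt (ht ▸ hgt)))
    exact ⟨s, s', h2, h3, Or.inr ⟨h4.2, h5.1⟩⟩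

/-- In a system of three paths any two of which meet, a path that is never on top and a path that is
never at the bottom could not cross each other (or, if they coincide, could not cross the others). -/
theorem IsSystem.convex_of_card_eq_three {S : Finset Path} (hS : IsSystem S) (h3 : S.card = 3)
    (hmeet : ∀ f ∈ S, ∀ g ∈ S, f ≠ g → ∃ t, f t = g t) : UpperConvex S ∨ LowerConvex S := by
  classical
  by_contra! hno
  simp only [UpperConvex, LowerConvex] at hno
  push Not at hno
  obtain ⟨⟨f, hf, hfup⟩, ⟨g, hg, hglow⟩⟩ := hno
  -- `f` is never the top path and `g` never the bottom path.
  have hother : ∀ a ∈ S, ∀ b ∈ S, a ≠ b → ∃ c ∈ S, c ≠ a ∧ c ≠ b ∧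
      ∀ d ∈ S, d = a ∨ d = b ∨ d = c := by
    intro a ha b hb hab
    have hc : ((S.erase a).erase b).card = 1 := by
      rw [Finset.card_erase_of_mem (Finset.mem_erase.mpr ⟨hab.symm, hb⟩),
        Finset.card_erase_of_mem ha, h3]
    obtain ⟨c, hc⟩ := Finset.card_eq_one.mp hc
    have hcm : c ∈ (S.erase a).erase b := by rw [hc]; exact Finset.mem_singleton_self c
    simp only [Finset.mem_erase] at hcm
    refine ⟨c, hcm.2.2, hcm.2.1, hcm.1, fun d hd => ?_⟩
    by_contra! hd'
    have : d ∈ (S.erase a).erase b := by simp [hd, hd']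
    rw [hc, Finset.mem_singleton] at this
    exact hd'.2.2 this
  have top : ∀ b ∈ S, ∀ c ∈ S, (∀ d ∈ S, d = f ∨ d = b ∨ d = c) → ∀ t, b t < f t → ¬ c t < f t := by
    intro b hb c hc hall t h1 h2
    refine hfup ⟨t, fun d hd hdf => ?_⟩
    rcases hall d hd with rfl | rfl | rfl
    exacts [absurd rfl hdf, h1, h2]
  have bot : ∀ b ∈ S, ∀ c ∈ S, (∀ d ∈ S, d = g ∨ d = b ∨ d = c) → ∀ t, g t < b t → ¬ g t < c t := by
    intro b hb c hc hall t h1 h2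
    refine hglow ⟨t, fun d hd hdg => ?_⟩
    rcases hall d hd with rfl | rfl | rfl
    exacts [absurd rfl hdg, h1, h2]
  by_cases hfg : f = g
  · subst hfg
    obtain ⟨a, ha, haf⟩ := Finset.exists_mem_ne (s := S) (by omega) f
    obtain ⟨b, hb, hbf, hba, hall⟩ := hother f hf a ha haf.symm
    obtain ⟨s, s', h1, h1', ⟨-, h2⟩ | ⟨h2, -⟩⟩ := hS.exists_lt_near hf ha hb haf.symm hbf.symm
      hba.symm (hmeet f hf a ha haf.symm)
    · exact bot a ha b hb hall s' h1' (h1'.trans h2)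
    · exact top a ha b hb hall s h1 (h2.trans h1)
  · obtain ⟨c, hc, hcf, hcg, hall⟩ := hother f hf g hg hfg
    obtain ⟨s, -, h1, -, ⟨h2, -⟩ | ⟨h2, -⟩⟩ := hS.exists_lt_near hf hg hc hfg hcf.symm hcg.symm
      (hmeet f hf g hg hfg)
    · exact bot f hf c hc (fun d hd => by rcases hall d hd with h | h | h <;> simp [h]) s h1
        (h1.trans h2)
    · exact top g hg c hc hall s h1 (h2.trans h1)

/-! ### Signatures -/

instance : DecidableEq Letter := fun a b => by
  cases a <;> cases b <;> first | exact isTrue rfl | exact isFalse (fun h => Letter.noConfusion h)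

instance : Finite Letter :=
  Finite.of_surjective (fun i : Fin 3 => if i = 0 then Letter.x else if i = 1 then Letter.y
    else Letter.z) fun l => by
    cases l
    exacts [⟨0, rfl⟩, ⟨1, rfl⟩, ⟨2, rfl⟩]

/-- The numbers of letters `x`, `y`, `z` in the initial segments of a word. -/
def prefixCounts (w : List Letter) : Set (ℕ × ℕ × ℕ) :=
  {v | ∃ p, p <+: w ∧ v = (p.count .x, p.count .y, p.count .z)}

theorem filter_le_prefix {α : Type*} [LinearOrder α] {l : List α} (hl : l.Pairwise (· < ·))
    (t : α) : l.filter (· ≤ t) <+: l := by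
  induction l with
  | nil => simp
  | cons a l ih =>
    rw [List.pairwise_cons] at hl
    by_cases h : a ≤ t
    · rw [List.filter_cons_of_pos (by simpa using h)]
      exact (List.prefix_cons_inj a).mpr (ih hl.2)
    · have : l.filter (· ≤ t) = [] := by
        rw [List.filter_eq_nil_iff]
        intro b hb
        have := hl.1 b hb
        simp only [decide_eq_true_eq, not_le] at h ⊢
        exact h.trans this
      rw [List.filter_cons_of_neg (by simpa using h), this]
      exact List.nil_prefix

theorem exists_eq_filter_le_of_prefix {α : Type*} [LinearOrder α] {l p : List α}
    (hl : l.Pairwise (· < ·)) {t₀ : α} (h0 : ∀ a ∈ l, t₀ < a) (hp : p <+: l) :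
    ∃ t, p = l.filter (· ≤ t) := by
  induction l generalizing p t₀ with
  | nil => exact ⟨t₀, by simpa using hp⟩
  | cons a l ih =>
    rw [List.pairwise_cons] at hl
    rcases p with _ | ⟨b, p⟩
    · refine ⟨t₀, (List.filter_eq_nil_iff.mpr fun c hc => ?_).symm⟩
      simpa using h0 c hc
    · obtain ⟨rfl, hp'⟩ := List.cons_prefix_cons.mp hp
      obtain ⟨t, rfl⟩ := ih hl.2 hl.1 hp'
      refine ⟨max b t, ?_⟩
      rw [List.filter_cons_of_pos (by simp)]
      congr 1
      refine List.filter_congr fun c hc => ?_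
      have := hl.1 c hc
      simp [this.not_ge]

variable {h : Path}

/-- The letter recorded at a crossing of three paths. At other times the value `z` is
meaningless. -/
noncomputable def letterAt (f g h : Path) (t : I) : Letter :=
  open Classical in if f t = g t then .x else if f t = h t then .y else .z

/-- The crossings in `[0, t]` are an initial segment of the list of all crossings, and all initial
segments arise in this way; so the profile is determined by the word of letters. -/
theorem profile_eq_prefixCounts {ts : List I} {w : List Letter} (p₁₂ : IsPair f g)
    (p₁₃ : IsPair f h) (p₂₃ : IsPair g h) (hno : ∀ t : I, ¬ (f t = g t ∧ g t = h t))
    (hts : ts.Pairwise (· < ·)) (hmem : ∀ t : I, t ∈ ts ↔ f t = g t ∨ f t = h t ∨ g t = h t)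
    (hw : List.Forall₂ (MarkedBy f g h) ts w) : profile f g h = prefixCounts w := by
  classical
  have hlet : ∀ {t l}, MarkedBy f g h t l → letterAt f g h t = l := by
    intro t l hl
    have := hno t
    cases l <;> simp only [MarkedBy] at hl <;> unfold letterAt
    · simp [hl]
    · rw [if_neg (fun e => this ⟨e, e.symm.trans hl⟩), if_pos hl]
    · rw [if_neg (fun e => this ⟨e, hl⟩), if_neg (fun e => this ⟨e.trans hl.symm, hl⟩)]
  have hw' : w = ts.map (letterAt f g h) := by
    clear hts hmem
    induction hw with
    | nil => rfl
    | cons h1 _ ih => rw [List.map_cons, ← ih, hlet h1]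
  have hcount : ∀ t (a b : Path) (l : Letter), (∀ s ∈ ts, letterAt f g h s = l ↔ a s = b s) →
      (∀ s, a s = b s → s ∈ ts) →
      ((ts.filter (· ≤ t)).map (letterAt f g h)).count l = crossCount a b t := by
    intro t a b l h1 h2
    have hnd : ((ts.filter (· ≤ t)).filter (fun s => letterAt f g h s = l)).Nodup :=
      (hts.nodup.filter _).filter _
    rw [List.count_eq_length_filter, List.filter_map, List.length_map, crossCount]
    have : {s : I | s ≤ t ∧ a s = b s} =
        (((ts.filter (· ≤ t)).filter (fun s => letterAt f g h s = l)).toFinset : Set I) := by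
      ext s
      simp only [Set.mem_ofPred_eq, List.coe_toFinset, List.mem_filter, decide_eq_true_eq]
      constructor
      · rintro ⟨h3, h4⟩
        exact ⟨⟨h2 s h4, h3⟩, (h1 s (h2 s h4)).mpr h4⟩
      · rintro ⟨⟨h3, h4⟩, h5⟩
        exact ⟨h4, (h1 s h3).mp h5⟩
    rw [this, Set.ncard_coe_finset, List.toFinset_card_of_nodup hnd]
    rfl
  have hpt : ∀ t, (crossCount f g t, crossCount f h t, crossCount g h t) =
      (((ts.filter (· ≤ t)).map (letterAt f g h)).count .x,
        ((ts.filter (· ≤ t)).map (letterAt f g h)).count .y,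
        ((ts.filter (· ≤ t)).map (letterAt f g h)).count .z) := by
    intro t
    have hmk : ∀ s ∈ ts, MarkedBy f g h s (letterAt f g h s) := by
      intro s hs
      rcases (hmem s).mp hs with e | e | e
      · rw [hlet (l := .x) e]; exact e
      · rw [hlet (l := .y) e]; exact e
      · rw [hlet (l := .z) e]; exact e
    have hiff : ∀ l, ∀ s ∈ ts, letterAt f g h s = l ↔ MarkedBy f g h s l := fun l s hs =>
      ⟨fun e => e ▸ hmk s hs, hlet⟩
    rw [hcount t f g .x (hiff .x) fun s e => (hmem s).mpr (Or.inl e),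
      hcount t f h .y (hiff .y) fun s e => (hmem s).mpr (Or.inr (Or.inl e)),
      hcount t g h .z (hiff .z) fun s e => (hmem s).mpr (Or.inr (Or.inr e))]
  ext v
  constructor
  · rintro ⟨t, rfl⟩
    refine ⟨(ts.filter (· ≤ t)).map (letterAt f g h), ?_, hpt t⟩
    rw [hw']
    exact (filter_le_prefix hts t).map _
  · rintro ⟨p, hp, rfl⟩
    rw [hw'] at hp
    obtain ⟨q, hq, rfl⟩ : ∃ q, q <+: ts ∧ p = q.map (letterAt f g h) := by
      obtain ⟨r, hr⟩ := hp
      obtain ⟨q, q', rfl, rfl, -⟩ := List.map_eq_append_iff.mp hr.symm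
      exact ⟨q, List.prefix_append _ _, rfl⟩
    have h0 : ∀ a ∈ ts, (0 : I) < a := fun a ha => by
      rcases (hmem a).mp ha with e | e | e
      exacts [p₁₂.pos_of_meet e, p₁₃.pos_of_meet e, p₂₃.pos_of_meet e]
    obtain ⟨t, rfl⟩ := exists_eq_filter_le_of_prefix hts h0 hq
    exact ⟨t, hpt t⟩

/-- The profile of the three paths of a system with signature `w` consists of the letter counts of
the initial segments of `w`. -/
theorem HasSignature.profile_eq {S : Finset Path} {w : List Letter} (hw : HasSignature S w)
    (hS : IsSystem S) (hfgh : (S : Set Path) = {f, g, h}) (h₁ : f 0 < g 0) (h₂ : g 0 < h 0) :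
    profile f g h = prefixCounts w := by
  obtain ⟨f', g', h', hS', h₁', h₂', ts, hts, hmem, hall⟩ := hw
  have hsub : ∀ a : Path, a ∈ S ↔ a = f ∨ a = g ∨ a = h := fun a => by
    rw [← Finset.mem_coe, hfgh]; simp
  have hsub' : ∀ a : Path, a ∈ S ↔ a = f' ∨ a = g' ∨ a = h' := fun a => by
    rw [← Finset.mem_coe, hS']; simp
  have hf := (hsub f).mpr (by simp)
  have hg := (hsub g).mpr (by simp)
  have hh := (hsub h).mpr (by simp)
  have key : f = f' ∧ g = g' ∧ h = h' := by
    rcases (hsub' f).mp hf with rfl | rfl | rfl <;> rcases (hsub' g).mp hg with rfl | rfl | rfl <;>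
      rcases (hsub' h).mp hh with rfl | rfl | rfl <;>
      first
      | exact ⟨rfl, rfl, rfl⟩
      | exact absurd h₁ (by linarith)
  obtain ⟨rfl, rfl, rfl⟩ := key
  exact profile_eq_prefixCounts (hS.isPair hf hg h₁) (hS.isPair hf hh (h₁.trans h₂))
    (hS.isPair hg hh h₂) (hS.no_triple f hf g hg h hh (fun e => h₁.ne (by rw [e]))
      (fun e => (h₁.trans h₂).ne (by rw [e])) (fun e => h₂.ne (by rw [e]))) hts hmem hall

theorem IsSystem.exists_hasSignature {S : Finset Path} (hS : IsSystem S) (h3 : S.card = 3) :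
    ∃ w, HasSignature S w := by
  classical
  obtain ⟨e, heS, hmono, hsurj⟩ := hS.exists_sorted h3
  have h₁ : e 0 0 < e 1 0 := hmono (by decide)
  have h₂ : e 1 0 < e 2 0 := hmono (by decide)
  have hfin : {t : I | e 0 t = e 1 t ∨ e 0 t = e 2 t ∨ e 1 t = e 2 t}.Finite :=
    (hS.isPair (heS 0) (heS 1) h₁).finite.union
      ((hS.isPair (heS 0) (heS 2) (h₁.trans h₂)).finite.union
        (hS.isPair (heS 1) (heS 2) h₂).finite)
  refine ⟨(hfin.toFinset.sort (· ≤ ·)).map (letterAt (e 0) (e 1) (e 2)), e 0, e 1, e 2, ?_, h₁, h₂,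
    hfin.toFinset.sort (· ≤ ·), Finset.sortedLT_sort _ |>.pairwise, fun t => ?_, ?_⟩
  · ext f
    simp only [Finset.mem_coe, Set.mem_insert_iff, Set.mem_singleton_iff]
    constructor
    · intro hf
      obtain ⟨i, rfl⟩ := hsurj f hf
      fin_cases i <;> simp
    · rintro (rfl | rfl | rfl) <;> exact heS _
  · rw [Finset.mem_sort, Set.Finite.mem_toFinset]
    rfl
  · rw [List.forall₂_map_right_iff, List.forall₂_same]
    intro t ht
    rw [Finset.mem_sort, Set.Finite.mem_toFinset] at ht
    unfold letterAt
    split_ifs with h1 h2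
    · exact h1
    · exact h2
    · exact (ht.resolve_left h1).resolve_left h2

theorem signatures_finite (k : ℕ) : (signatures k).Finite := by
  classical
  refine (List.finite_length_le Letter (k + (k + k))).subset ?_
  rintro w ⟨S, ⟨hS, hk⟩, -, f, g, h, hfgh, h₁, h₂, ts, hts, hmem, hall⟩
  have hsub : ∀ a : Path, a ∈ S ↔ a = f ∨ a = g ∨ a = h := fun a => by
    rw [← Finset.mem_coe, hfgh]; simp
  have hf := (hsub f).mpr (by simp)
  have hg := (hsub g).mpr (by simp)
  have hh := (hsub h).mpr (by simp)
  have b₁ := (hk f hf g hg fun e => h₁.ne (by rw [e])).2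
  have b₂ := (hk f hf h hh fun e => (h₁.trans h₂).ne (by rw [e])).2
  have b₃ := (hk g hg h hh fun e => h₂.ne (by rw [e])).2
  have hset : {t : I | f t = g t} ∪ ({t : I | f t = h t} ∪ {t : I | g t = h t}) =
      (ts.toFinset : Set I) := by
    ext t
    simp [hmem]
  change w.length ≤ _
  rw [← hall.length_eq, ← List.toFinset_card_of_nodup hts.nodup, ← Set.ncard_coe_finset, ← hset]
  have c₁ := Set.ncard_union_le {t : I | f t = g t} ({t : I | f t = h t} ∪ {t : I | g t = h t})
  have c₂ := Set.ncard_union_le {t : I | f t = h t} {t : I | g t = h t}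
  omega

theorem IsCrossingSystem.subset {k : ℕ} {S T : Finset Path} (hS : IsCrossingSystem k S)
    (hTS : T ⊆ S) (hT : 3 ≤ T.card) : IsCrossingSystem k T where
  left :=
    { three_le_card := hT
      left_ne := fun f hf g hg => hS.1.left_ne f (hTS hf) g (hTS hg)
      right_ne := fun f hf g hg => hS.1.right_ne f (hTS hf) g (hTS hg)
      finite_inter := fun f hf g hg => hS.1.finite_inter f (hTS hf) g (hTS hg)
      cross := fun f hf g hg => hS.1.cross f (hTS hf) g (hTS hg)
      no_triple := fun f hf g hg h hh => hS.1.no_triple f (hTS hf) g (hTS hg) h (hTS hh) }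
  right := fun f hf g hg => hS.2 f (hTS hf) g (hTS hg)

theorem IsCrossingSystem.exists_meet {k : ℕ} {S : Finset Path} (hS : IsCrossingSystem k S) :
    ∀ f ∈ S, ∀ g ∈ S, f ≠ g → ∃ t, f t = g t := fun f hf g hg hfg =>
  Set.nonempty_of_ncard_ne_zero (Nat.one_le_iff_ne_zero.mp (hS.2 f hf g hg hfg).1)

/-! ### Ramsey's theorem -/

/-- For a colouring of the `(r+1)`-subsets, there is a large set in which the colour of an
`(r+1)`-subset depends only on its least element. -/
theorem exists_end_homogeneous {κ : Type*} (r : ℕ)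
    (ih : ∀ n : ℕ, ∃ R : ℕ, ∀ V : Finset ℕ, R ≤ V.card → ∀ c : Finset ℕ → κ,
      ∃ A ⊆ V, A.card = n ∧ ∃ d : κ, ∀ s ⊆ A, s.card = r → c s = d) (L : ℕ) :
    ∃ R : ℕ, ∀ V : Finset ℕ, R ≤ V.card → ∀ c : Finset ℕ → κ,
      ∃ A ⊆ V, A.card = L ∧ ∃ d : ℕ → κ, ∀ a ∈ A, ∀ s ⊆ A, s.card = r → (∀ b ∈ s, a < b) →
        c (insert a s) = d a := by
  classical
  induction L with
  | zero =>
    refine ⟨0, fun V _ c => ⟨∅, by simp, rfl, fun a => c {a}, by simp⟩⟩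
  | succ L hL =>
    obtain ⟨R₁, h₁⟩ := hL
    obtain ⟨R₂, h₂⟩ := ih R₁
    refine ⟨R₂ + 1, fun V hV c => ?_⟩
    have hne : V.Nonempty := Finset.card_pos.mp (by omega)
    -- Among the `(r+1)`-subsets with least element `v`, the colour is an `r`-set colouring of the
    -- rest, which is made constant on `B`; the argument continues inside `B`.
    set v := V.min' hne
    have hvV : v ∈ V := Finset.min'_mem _ _
    obtain ⟨B, hBV, hB, e, he⟩ := h₂ (V.erase v) (by rw [Finset.card_erase_of_mem hvV]; omega)
      (fun s => c (insert v s))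
    obtain ⟨A, hAB, hA, d, hd⟩ := h₁ B hB.ge c
    have hlt : ∀ b ∈ A, v < b := fun b hb => by
      have hb' := hBV (hAB hb)
      exact lt_of_le_of_ne (Finset.min'_le _ _ (Finset.mem_of_mem_erase hb'))
        (Finset.ne_of_mem_erase hb').symm
    have hvA : v ∉ A := fun h => lt_irrefl _ (hlt v h)
    refine ⟨insert v A, ?_, by rw [Finset.card_insert_of_notMem hvA, hA],
      fun a => if a = v then e else d a, ?_⟩
    · refine Finset.insert_subset hvV ((hAB.trans hBV).trans (Finset.erase_subset _ _))
    · intro a ha s hs hsc hlt'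
      have hvs : v ∉ s := fun h => by
        have h1 := hlt' v h
        rcases Finset.mem_insert.mp ha with rfl | ha
        · exact lt_irrefl _ h1
        · exact lt_asymm h1 (hlt a ha)
      have hsA : s ⊆ A := (Finset.subset_insert_iff_of_notMem hvs).mp hs
      by_cases hav : a = v
      · simp only [hav, if_true]
        exact he s (hsA.trans hAB) hsc
      · simp only [hav, if_false]
        exact hd a (Finset.mem_of_mem_insert_of_ne ha hav) s hsA hsc hlt'

/-- Ramsey's theorem for `r`-uniform hypergraphs with finitely many colours. -/
theorem exists_ramsey {κ : Type*} [Finite κ] [Nonempty κ] (r n : ℕ) :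
    ∃ R : ℕ, ∀ V : Finset ℕ, R ≤ V.card → ∀ c : Finset ℕ → κ,
      ∃ A ⊆ V, A.card = n ∧ ∃ d : κ, ∀ s ⊆ A, s.card = r → c s = d := by
  classical
  have := Fintype.ofFinite κ
  induction r generalizing n with
  | zero =>
    refine ⟨n, fun V hV c => ?_⟩
    obtain ⟨A, hAV, hA⟩ := Finset.exists_subset_card_eq hV
    refine ⟨A, hAV, hA, c ∅, fun s _ hs => by rw [Finset.card_eq_zero.mp hs]⟩
  | succ r ih =>
    obtain ⟨R, hR⟩ := exists_end_homogeneous r ih (Fintype.card κ * n)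
    refine ⟨R, fun V hV c => ?_⟩
    obtain ⟨A, hAV, hA, d, hd⟩ := hR V hV c
    -- By pigeonhole, `n` elements of `A` have the same value of `d`.
    obtain ⟨y, -, hy⟩ := Finset.exists_le_card_fiber_of_mul_le_card_of_maps_to
      (s := A) (t := Finset.univ) (f := d) (n := n) (fun _ _ => Finset.mem_univ _)
      Finset.univ_nonempty (by rw [hA, Finset.card_univ])
    obtain ⟨B, hBA, hB⟩ := Finset.exists_subset_card_eq hy
    have hBA' : B ⊆ A := hBA.trans (Finset.filter_subset _ _)
    refine ⟨B, hBA'.trans hAV, hB, y, fun s hs hsc => ?_⟩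
    have hne : s.Nonempty := Finset.card_pos.mp (by omega)
    have hm := Finset.min'_mem s hne
    rw [← Finset.insert_erase hm,
      hd _ (hBA' (hs hm)) _ ((Finset.erase_subset _ _).trans (hs.trans hBA'))
        (by rw [Finset.card_erase_of_mem hm, hsc]; rfl)
        (fun b hb => lt_of_le_of_ne (Finset.min'_le _ _ (Finset.mem_of_mem_erase hb))
          (Finset.ne_of_mem_erase hb).symm)]
    exact (Finset.mem_filter.mp (hBA (hs hm))).2

theorem exists_ramseyBound (n M : ℕ) : ∃ R, RamseyBound n M R := by
  classical
  rcases Nat.eq_zero_or_pos M with rfl | hM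
  · -- Without colours there is no colouring once triples exist.
    refine ⟨3, fun N hN c => ?_⟩
    obtain ⟨T, -, hT⟩ := Finset.exists_subset_card_eq
      (show 3 ≤ (Finset.univ : Finset (Fin N)).card by simpa using hN)
    exact (c ⟨T, hT⟩).elim0
  · have : Nonempty (Fin M) := ⟨⟨0, hM⟩⟩
    obtain ⟨R, hR⟩ := exists_ramsey (κ := Fin M) 3 n
    refine ⟨R, fun N hN c => ?_⟩
    obtain ⟨A, hA, hAc, d, hd⟩ := hR (Finset.range N) (by simpa using hN) (fun s =>
      if h : ((Finset.univ : Finset (Fin N)).filter (fun i : Fin N => (i : ℕ) ∈ s)).card = 3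
      then c ⟨_, h⟩ else ⟨0, hM⟩)
    refine ⟨Finset.univ.filter (fun i : Fin N => (i : ℕ) ∈ A), ?_, ?_⟩
    · have : A = (Finset.univ.filter (fun i : Fin N => (i : ℕ) ∈ A)).map Fin.valEmbedding := by
        ext a
        simp only [Finset.mem_map, Finset.mem_filter, Finset.mem_univ, true_and,
          Fin.valEmbedding_apply]
        exact ⟨fun h => ⟨⟨a, Finset.mem_range.mp (hA h)⟩, h, rfl⟩, fun ⟨i, hi, e⟩ => e ▸ hi⟩
      have h2 := congrArg Finset.card this
      rw [Finset.card_map] at h2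
      omega
    · have key : ∀ T : {T : Finset (Fin N) // T.card = 3},
          T.1 ⊆ Finset.univ.filter (fun i : Fin N => (i : ℕ) ∈ A) → c T = d := by
        rintro ⟨T, hT⟩ hTA
        have h1 := hd (T.map Fin.valEmbedding) (by
          intro a ha
          obtain ⟨i, hi, rfl⟩ := Finset.mem_map.mp ha
          exact (Finset.mem_filter.mp (hTA hi)).2) (by rw [Finset.card_map, hT])
        have h2 : (Finset.univ : Finset (Fin N)).filter
            (fun i : Fin N => (i : ℕ) ∈ T.map Fin.valEmbedding) = T := by
          ext i
          simp [Fin.val_inj]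
        rw [dif_pos (by rw [h2, hT])] at h1
        rw [← h1]
        congr 2
        exact h2.symm
      intro T T' hT hT'
      rw [key T hT, key T' hT']

/-! ### From Ramsey's theorem to convex subsystems -/

/-- A crossing system all of whose triples share a signature is upper or lower convex. -/
theorem IsCrossingSystem.convex_of_hasSignature {k : ℕ} {T : Finset Path}
    (hT : IsCrossingSystem k T) {w : List Letter}
    (hw : ∀ U ⊆ T, U.card = 3 → HasSignature U w) : UpperConvex T ∨ LowerConvex T := by
  classical
  rcases hT.1.three_le_card.eq_or_lt with h3 | h4
  · exact hT.1.convex_of_card_eq_three h3.symm hT.exists_meet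
  refine hT.1.convex_of_hasProfile h4 hT.exists_meet (P := prefixCounts w) ?_
  intro f hf g hg h hh h₁ h₂
  have hsub : ({f, g, h} : Finset Path) ⊆ T := by
    simp [Finset.insert_subset_iff, hf, hg, hh]
  have hcard : ({f, g, h} : Finset Path).card = 3 :=
    Finset.card_eq_three.mpr ⟨f, g, h, fun e => h₁.ne (by rw [e]),
      fun e => (h₁.trans h₂).ne (by rw [e]), fun e => h₂.ne (by rw [e]), rfl⟩
  exact (hw _ hsub hcard).profile_eq (hT.subset hsub hcard.ge).1 (by simp) h₁ h₂

theorem cupsCapsBound_of_ramseyBound {k n R : ℕ} (hn : 3 ≤ n)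
    (hR : RamseyBound n (signatures k).ncard R) : CupsCapsBound k n R := by
  classical
  constructor
  · -- The Ramsey property fails for the empty set of vertices, as `n` is positive.
    refine Nat.pos_of_ne_zero fun h0 => ?_
    obtain ⟨A, hA, -⟩ := hR 0 h0.le fun T => by
      have h1 := T.2
      rw [Finset.eq_empty_of_isEmpty T.1] at h1
      simp at h1
    rw [Finset.eq_empty_of_isEmpty A] at hA
    simp at hA
    omega
  intro S hS hRS
  have := (signatures_finite k).to_subtype
  have hcard : Nat.card (signatures k) = (signatures k).ncard := rfl
  let toFin : signatures k ≃ Fin (signatures k).ncard := Finite.equivFinOfCardEq hcard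
  let e : Fin S.card ↪ Path := S.equivFin.symm.toEmbedding.trans (Function.Embedding.subtype _)
  have heS : ∀ A : Finset (Fin S.card), A.map e ⊆ S := fun A f hf => by
    obtain ⟨i, -, rfl⟩ := Finset.mem_map.mp hf
    exact (S.equivFin.symm i).2
  have hsig : ∀ T : {T : Finset (Fin S.card) // T.card = 3},
      ∃ w : signatures k, HasSignature (T.1.map e) w.1 := fun T => by
    have h3 : (T.1.map e).card = 3 := by rw [Finset.card_map, T.2]
    have hT := hS.subset (heS T.1) h3.ge
    obtain ⟨w, hw⟩ := hT.1.exists_hasSignature h3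
    exact ⟨⟨w, _, hT, h3, hw⟩, hw⟩
  choose c hc using hsig
  -- Colour each triple by a signature of it.
  obtain ⟨A, hA, hmono⟩ := hR S.card hRS fun T => toFin (c T)
  obtain ⟨B, hBA, hB⟩ := Finset.exists_subset_card_eq hA
  have hBc : (B.map e).card = n := by rw [Finset.card_map, hB]
  obtain ⟨T₀, hT₀B, hT₀⟩ := Finset.exists_subset_card_eq (show 3 ≤ B.card by omega)
  refine ⟨B.map e, heS B, hBc, (hS.subset (heS B) (by omega)).convex_of_hasSignature
    (w := (c ⟨T₀, hT₀⟩).1) fun U hU hU3 => ?_⟩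
  obtain ⟨U', hU'B, rfl⟩ := Finset.subset_map_iff.mp hU
  rw [Finset.card_map] at hU3
  have h1 := toFin.injective (hmono ⟨U', hU3⟩ ⟨T₀, hT₀⟩ (hU'B.trans hBA) (hT₀B.trans hBA))
  rw [← h1]
  exact hc ⟨U', hU3⟩

end PathSystem

theorem mainTheorem3 (k n : ℕ) (hk : 1 ≤ k) (hn : 3 ≤ n) :
    (PathSystem.signatures k).Finite ∧
      ∃ C R : ℕ, IsLeast {C' : ℕ | PathSystem.CupsCapsBound k n C'} C ∧
        IsLeast {R' : ℕ | PathSystem.RamseyBound n (PathSystem.signatures k).ncard R'} R ∧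
        C ≤ R := by
  classical
  have hR := PathSystem.exists_ramseyBound n (PathSystem.signatures k).ncard
  have hCR := PathSystem.cupsCapsBound_of_ramseyBound hn (Nat.find_spec hR)
  have hC : ∃ C, PathSystem.CupsCapsBound k n C := ⟨_, hCR⟩
  exact ⟨PathSystem.signatures_finite k, Nat.find hC, Nat.find hR,
    ⟨Nat.find_spec hC, fun _ h => Nat.find_min' hC h⟩,
    ⟨Nat.find_spec hR, fun _ h => Nat.find_min' hR h⟩, Nat.find_min' hC hCR⟩
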